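/- Let $K>0$. There is a constant $C>0$ depending only on $K$ such that the following holds. Let $m,n,k,r\ge 1$ be integers with $k\le\min\{m,n\}$, let $0<p\le 1$, $\varepsilon>0$ and $0<\eta<1$ (with $\eta\le 1/2$ in case $m=n=1$), and suppose that $$k\ \ge\ r\ \ge\ C\,\log\frac{mn}{\eta}\cdot\max\Big\{\frac{p}{\varepsilon^2},\frac1\varepsilon\Big\}.$$ Let $X\in\mathbb R^{m\times n}$ have rank $k$, and let $X=U\Sigma V^\top$ be any thin singular value decomposition ($U\in\mathbb R^{m\times k}$ and $V\in\mathbb R^{n\times k}$ with orthonormal columns, $\Sigma\in\mathbb R^{k\times k}$ diagonal with positive diagonal entries). Let $\delta$ be Bernoulli$(p)$, i.e. $\mathbb P(\delta=1)=p=1-\mathbb P(\delta=0)$, and let $\xi$ be a random variable independent of $\delta$ with $\mathbb E\xi=0$, $\mathbb E\xi^2=1$ and $\|\xi\|_{\Psi_2}:=\inf\{t>0:\mathbb E\exp(\xi^2/t^2)\le 2\}\le K$. Let $Q\in\mathbb R^{k\times r}$ be a random matrix whose entries are independent copies of $r^{-1/2}\delta\xi$, and put $$Y=\frac1p\,(U\Sigma^{1/2})\,QQ^\top\,(V\Sigma^{1/2})^\top\in\mathbb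 R^{m\times n}.$$ Then $Y$ always has rank at most $r$, and with probability at least $1-\eta$, $$\max_{i,j}|X_{ij}-Y_{ij}|\ \le\ \frac{k\varepsilon}{p\sqrt{mn}}\,\sqrt{\mu_{\mathrm{col}}\,\mu_{\mathrm{row}}}\;\|X\|_{\mathrm{op}},$$ where $\|X\|_{\mathrm{op}}$ is the spectral norm and $$\mu_{\mathrm{col}}=\frac mk\max_{1\le i\le m}\|U^\top e_i\|_2^2,\qquad \mu_{\mathrm{row}}=\frac nk\max_{1\le j\le n}\|V^\top e_j\|_2^2 ,$$ with $e_i$ and $e_j$ the standard basis vectors of $\mathbb R^m$ and $\mathbb R^n$. -/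

import Mathlib

open MeasureTheory ProbabilityTheory
open scoped ENNReal NNReal Matrix

noncomputable section

/-- The sub-Gaussian norm `inf {t > 0 : E exp(ξ² / t²) ≤ 2}`, with value `∞` if there is no
such `t`. -/
def psiTwoNorm {Ω : Type*} [MeasurableSpace Ω] (ξ : Ω → ℝ) (P : Measure Ω) : ℝ≥0∞ :=
  ⨅ (t : ℝ≥0) (_ : 0 < t) (_ : ∫⁻ ω, ENNReal.ofReal (Real.exp (ξ ω ^ 2 / (t : ℝ) ^ 2)) ∂P ≤ 2),
    (t : ℝ≥0∞)

/-- The maximum norm `max_{i,j} |a_{ij}|`. -/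
def maxNorm {m n : ℕ} (A : Matrix (Fin m) (Fin n) ℝ) : ℝ :=
  ⨆ ij : Fin m × Fin n, |A ij.1 ij.2|

/-- The spectral norm, i.e. the operator norm between Euclidean spaces. -/
def spectralNorm₂ {m n : ℕ} (A : Matrix (Fin m) (Fin n) ℝ) : ℝ :=
  ‖LinearMap.toContinuousLinearMap (Matrix.toEuclideanLin A)‖

/-- `X = U Σ Vᵀ` with `Σ = diag(σ)`, is a thin singular value decomposition with `k` (positive)
singular values: the columns of `U` and those of `V` are orthonormal. -/
structure IsThinSVD {m n k : ℕ} (X : Matrix (Fin m) (Fin n) ℝ) (U : Matrix (Fin m) (Fin k) ℝ)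
    (σ : Fin k → ℝ) (V : Matrix (Fin n) (Fin k) ℝ) : Prop where
  left_orthonormal : Uᵀ * U = 1
  right_orthonormal : Vᵀ * V = 1
  singular_pos : ∀ l, 0 < σ l
  eq_mul : X = U * Matrix.diagonal σ * Vᵀ

/-- The coherence `(m / k) max_i ‖Uᵀ e_i‖₂²` of the column space of an `m × k` matrix `U` with
orthonormal columns. For a thin SVD `X = U Σ Vᵀ`, the column space coherence of `X` is
`coherence U` and its row space coherence is `coherence V`. -/
def coherence {m k : ℕ} (U : Matrix (Fin m) (Fin k) ℝ) : ℝ :=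
  (m : ℝ) / (k : ℝ) * ⨆ i : Fin m, ‖WithLp.toLp 2 (Uᵀ *ᵥ Pi.single i 1)‖ ^ 2

/-- `δ ∼ Bernoulli(p)`, and `ξ` is a centered sub-Gaussian variable of variance one, independent
of `δ`, whose sub-Gaussian norm is at most `K`. -/
structure IsSparsifiedPair {Ω : Type*} [MeasurableSpace Ω] (P : Measure Ω) (p : unitInterval)
    (K : ℝ) (δ ξ : Ω → ℝ) : Prop where
  bernoulli : HasLaw δ (bernoulliMeasure 1 0 p) P
  aemeasurable : AEMeasurable ξ P
  centered : ∫ ω, ξ ω ∂P = 0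
  second_moment : ∫ ω, ξ ω ^ 2 ∂P = 1
  psiTwoNorm_le : psiTwoNorm ξ P ≤ ENNReal.ofReal K
  indep : IndepFun δ ξ P

/-- The entries of the random `k × r` matrix `Q` are independent copies of `r^{-1/2} δ ξ`. -/
structure IsSparsifiedSketch {Ω Ω₀ : Type*} [MeasurableSpace Ω] [MeasurableSpace Ω₀]
    (P : Measure Ω) (P₀ : Measure Ω₀) {k r : ℕ} (δ ξ : Ω₀ → ℝ)
    (Q : Ω → Matrix (Fin k) (Fin r) ℝ) : Prop where
  indep : iIndepFun (fun (ab : Fin k × Fin r) (ω : Ω) => Q ω ab.1 ab.2) P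
  copies : ∀ a b, IdentDistrib (fun ω => Q ω a b)
    (fun ω => (Real.sqrt (r : ℝ))⁻¹ * (δ ω * ξ ω)) P P₀

/-- The output of the algorithm run with the thin SVD `(U, σ, V)` and the sketch `Q`:
`Y = p⁻¹ Ũ Q Qᵀ Ṽᵀ` with `Ũ = U Σ^{1/2}` and `Ṽ = V Σ^{1/2}`. -/
def sketchOutput {m n k r : ℕ} (p : ℝ) (U : Matrix (Fin m) (Fin k) ℝ) (σ : Fin k → ℝ)
    (V : Matrix (Fin n) (Fin k) ℝ) (Q : Matrix (Fin k) (Fin r) ℝ) : Matrix (Fin m) (Fin n) ℝ :=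
  p⁻¹ • ((U * Matrix.diagonal fun l => Real.sqrt (σ l)) * Q * Qᵀ *
    (V * Matrix.diagonal fun l => Real.sqrt (σ l))ᵀ)

end

/-! Let `u i` and `v j` be the rows of `U Σ^{1/2}` and `V Σ^{1/2}`, and `x b` the columns of `√r Q`.
Then `X i j = ⟨u i, v j⟩`, and `Y i j` is the average over the `r` independent columns of `p⁻¹ ⟨u i,
x b⟩ ⟨v j, x b⟩`, whose mean is `X i j`. A Bernstein bound for each entry and a union bound over the
`m n` entries therefore suffice; the rank bound is immediate from the inner dimension `r`.

The crux is a variance proxy of order `p` rather than 1. For this the moment generating function is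
kept in the form `1 + p (exp (L s²) - 1)`. This form survives sums of independent coordinates
(`prod_one_add_mul_sub_one_le`). Averaging over a Gaussian `s` turns it into `E exp (c A²) ≤ 1 + p`
for a linear form `A` (`integral_exp_sq_le_of_integral_exp_le`), and a product of two such forms
then has log-mgf at most its linear term plus `O(λ² p)` (`integral_exp_mul_mul_le`). Finally `σ l ≤
‖X‖` bounds the norms of `u i` and `v j` by the coherences. -/

/-! ### Elementary inequalities for the exponential. -/

theorem exp_le_add_exp_sq (x : ℝ) : Real.exp x ≤ x + Real.exp (x ^ 2) := by
  have h2 := Real.add_one_le_exp (x ^ 2)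
  rcases le_total |x| 1 with h | h
  · have := (abs_le.1 (Real.abs_exp_sub_one_sub_id_le h)).2
    linarith
  · rcases le_total 0 x with hx | hx
    · rw [abs_of_nonneg hx] at h
      have : Real.exp x ≤ Real.exp (x ^ 2) := Real.exp_le_exp.2 (by nlinarith)
      linarith
    · rw [abs_of_nonpos hx] at h
      have : Real.exp x ≤ 1 := Real.exp_le_one_iff.2 hx
      nlinarith

theorem exp_le_one_add_add_sq_mul_exp_abs (x : ℝ) :
    Real.exp x ≤ 1 + x + x ^ 2 * Real.exp |x| := by
  have h := Complex.norm_exp_sub_sum_le_norm_mul_exp (x : ℂ) 2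
  have e : Complex.exp x - ∑ m ∈ Finset.range 2, (x : ℂ) ^ m / (m.factorial : ℂ)
      = ((Real.exp x - (1 + x) : ℝ) : ℂ) := by
    simp [Finset.sum_range_succ]
  rw [e, Complex.norm_real, Complex.norm_real, Real.norm_eq_abs, Real.norm_eq_abs, sq_abs] at h
  have := (abs_le.1 h).2
  linarith

/-- The right side vanishes at 0: after integration, `E exp - 1` is what produces the factor `p`. -/
theorem sq_mul_exp_half_le {x : ℝ} (hx : 0 ≤ x) :
    x ^ 2 * Real.exp (x / 2) ≤ 8 * (Real.exp x - 1) := by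
  have h1 := Real.quadratic_le_exp_of_nonneg (x := x / 2) (by linarith)
  have h2 : Real.exp x = Real.exp (x / 2) * Real.exp (x / 2) := by
    rw [← Real.exp_add]; ring_nf
  have h3 := Real.one_le_exp (x := x / 2) (by linarith)
  rw [h2]
  nlinarith [mul_le_mul_of_nonneg_left h1 (Real.exp_pos (x / 2)).le,
    mul_nonneg (Real.exp_pos (x / 2)).le hx]

/-! ### From the sub-Gaussian norm to the moment generating function. -/

section Subgaussian

variable {Ω : Type*} [MeasurableSpace Ω] {P : Measure Ω}

theorem lintegral_exp_sq_le_of_psiTwoNorm_lt {ξ : Ω → ℝ} {K : ℝ}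
    (h : psiTwoNorm ξ P < ENNReal.ofReal K) :
    ∫⁻ ω, ENNReal.ofReal (Real.exp (ξ ω ^ 2 / K ^ 2)) ∂P ≤ 2 := by
  simp only [psiTwoNorm, iInf_lt_iff] at h
  obtain ⟨t, ht, h2, hlt⟩ := h
  have htK : (t : ℝ) ≤ K := by
    have := (ENNReal.lt_ofReal_iff_toReal_lt (by simp)).1 hlt
    simpa using this.le
  refine (lintegral_mono fun ω => ?_).trans h2
  have : (0 : ℝ) < t := by exact_mod_cast ht
  gcongr

theorem integral_exp_sq_le_of_psiTwoNorm_lt {ξ : Ω → ℝ} {K : ℝ}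
    (hξ : AEMeasurable ξ P) (h : psiTwoNorm ξ P < ENNReal.ofReal K) :
    Integrable (fun ω => Real.exp (ξ ω ^ 2 / K ^ 2)) P ∧
      ∫ ω, Real.exp (ξ ω ^ 2 / K ^ 2) ∂P ≤ 2 := by
  have h2 := lintegral_exp_sq_le_of_psiTwoNorm_lt h
  have hm : AEStronglyMeasurable (fun ω => Real.exp (ξ ω ^ 2 / K ^ 2)) P :=
    ((hξ.pow_const 2).div_const _).exp.aestronglyMeasurable
  constructor
  · refine ⟨hm, ?_⟩
    rw [hasFiniteIntegral_iff_ofReal (ae_of_all _ fun ω => (Real.exp_pos _).le)]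
    exact h2.trans_lt (by simp)
  · rw [integral_eq_lintegral_of_nonneg_ae (ae_of_all _ fun ω => (Real.exp_pos _).le) hm]
    exact ENNReal.toReal_le_of_le_ofReal (by norm_num) (by simpa using h2)

theorem integrable_rpow_of_integral_le [IsProbabilityMeasure P] {f : Ω → ℝ} (hf : Integrable f P)
    (h1 : ∀ ω, 1 ≤ f ω) {θ : ℝ} (h0 : 0 ≤ θ) (hθ : θ ≤ 1) :
    Integrable (fun ω => f ω ^ θ) P ∧ ∫ ω, f ω ^ θ ∂P ≤ (∫ ω, f ω ∂P) ^ θ := by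
  have hi : Integrable (fun ω => f ω ^ θ) P := by
    refine hf.mono' (hf.aemeasurable.pow_const θ).aestronglyMeasurable (ae_of_all _ fun ω => ?_)
    have := h1 ω
    rw [Real.norm_of_nonneg (by positivity)]
    simpa using Real.rpow_le_rpow_of_exponent_le this hθ
  refine ⟨hi, ?_⟩
  have := (Real.concaveOn_rpow h0 hθ).le_map_integral (μ := P) (f := f)
    (Real.continuous_rpow_const h0).continuousOn isClosed_Ici
    (ae_of_all _ fun ω => zero_le_one.trans (h1 ω)) hf hi
  simpa using this

/-- For `K² s² ≤ 1`, use `exp x ≤ x + exp (x²)`: the linear term has mean zero, and Jensen for the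
power `K² s²` bounds the rest by `2 ^ (K² s²)`. For larger `s`, Young's inequality `s ξ ≤ K² s² / 2
+ ξ² / (2 K²)` is enough, the leftover constant `exp (1/2)` being absorbed. -/
theorem integral_exp_mul_le_of_integral_exp_sq_le [IsProbabilityMeasure P] {ξ : Ω → ℝ} {K : ℝ}
    (hK : 0 < K) (hξ : AEMeasurable ξ P) (h0 : ∫ ω, ξ ω ∂P = 0)
    (hi : Integrable (fun ω => Real.exp (ξ ω ^ 2 / K ^ 2)) P)
    (h2 : ∫ ω, Real.exp (ξ ω ^ 2 / K ^ 2) ∂P ≤ 2) (s : ℝ) :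
    Integrable (fun ω => Real.exp (s * ξ ω)) P ∧
      ∫ ω, Real.exp (s * ξ ω) ∂P ≤ Real.exp (K ^ 2 * s ^ 2) := by
  have hone : ∀ ω, 1 ≤ Real.exp (ξ ω ^ 2 / K ^ 2) := fun ω => Real.one_le_exp (by positivity)
  have he : (2 : ℝ) ≤ Real.exp 1 := by linarith [Real.add_one_le_exp (1 : ℝ)]
  have hpow : ∀ θ : ℝ, 0 ≤ θ → (∫ ω, Real.exp (ξ ω ^ 2 / K ^ 2) ∂P) ^ θ ≤ Real.exp θ := by
    intro θ hθ
    have : Real.exp θ = Real.exp 1 ^ θ := by rw [← Real.exp_mul]; simp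
    rw [this]
    exact Real.rpow_le_rpow (integral_nonneg fun ω => (Real.exp_pos _).le) (h2.trans he) hθ
  have hexp : ∀ θ ω, Real.exp (ξ ω ^ 2 / K ^ 2) ^ θ = Real.exp (ξ ω ^ 2 / K ^ 2 * θ) := by
    intro θ ω; rw [Real.exp_mul]
  have key : ∀ ω, Real.exp (s * ξ ω) ≤
      Real.exp (K ^ 2 * s ^ 2 / 2) * Real.exp (ξ ω ^ 2 / K ^ 2) ^ (1 / 2 : ℝ) := by
    intro ω
    rw [hexp, ← Real.exp_add, Real.exp_le_exp]
    have : ξ ω ^ 2 / K ^ 2 = (ξ ω / K) ^ 2 := by rw [div_pow]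
    have h3 : s * ξ ω = (K * s) * (ξ ω / K) := by field_simp
    rw [this, h3]
    nlinarith [sq_nonneg (K * s - ξ ω / K)]
  obtain ⟨hi1, hb1⟩ := integrable_rpow_of_integral_le hi hone (θ := 1 / 2) (by norm_num)
    (by norm_num)
  have hint : Integrable (fun ω => Real.exp (s * ξ ω)) P := by
    refine (hi1.const_mul (Real.exp (K ^ 2 * s ^ 2 / 2))).mono'
      (hξ.const_mul s).exp.aestronglyMeasurable (ae_of_all _ fun ω => ?_)
    rw [Real.norm_of_nonneg (Real.exp_pos _).le]
    exact key ω
  refine ⟨hint, ?_⟩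
  have hKs : 0 ≤ K ^ 2 * s ^ 2 := by positivity
  rcases le_total (K ^ 2 * s ^ 2) 1 with h | h
  · obtain ⟨hi2, hb2⟩ := integrable_rpow_of_integral_le hi hone hKs h
    have hξi : Integrable ξ P := by
      refine (hi.const_mul K).mono' hξ.aestronglyMeasurable (ae_of_all _ fun ω => ?_)
      have h3 := Real.add_one_le_exp (ξ ω ^ 2 / K ^ 2)
      have h4 : |ξ ω| / K ≤ ξ ω ^ 2 / K ^ 2 + 1 := by
        have : ξ ω ^ 2 / K ^ 2 = (|ξ ω| / K) ^ 2 := by rw [div_pow, sq_abs]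
        rw [this]; nlinarith [sq_nonneg (|ξ ω| / K - 1)]
      have := h4.trans h3
      rw [div_le_iff₀ hK] at this
      rw [Real.norm_eq_abs]; linarith
    calc ∫ ω, Real.exp (s * ξ ω) ∂P
        ≤ ∫ ω, (s * ξ ω + Real.exp (ξ ω ^ 2 / K ^ 2) ^ (K ^ 2 * s ^ 2)) ∂P := by
          refine integral_mono hint ((hξi.const_mul s).add hi2) fun ω => ?_
          have := exp_le_add_exp_sq (s * ξ ω)
          have h5 : ξ ω ^ 2 / K ^ 2 * (K ^ 2 * s ^ 2) = (s * ξ ω) ^ 2 := by field_simp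
          simp only [hexp, h5]
          exact this
      _ = ∫ ω, Real.exp (ξ ω ^ 2 / K ^ 2) ^ (K ^ 2 * s ^ 2) ∂P := by
          rw [integral_add (hξi.const_mul s) hi2, integral_const_mul, h0]; ring
      _ ≤ _ := hb2.trans (hpow _ hKs)
  · calc ∫ ω, Real.exp (s * ξ ω) ∂P
        ≤ ∫ ω, Real.exp (K ^ 2 * s ^ 2 / 2) * Real.exp (ξ ω ^ 2 / K ^ 2) ^ (1 / 2 : ℝ) ∂P :=
          integral_mono hint (hi1.const_mul _) key
      _ = Real.exp (K ^ 2 * s ^ 2 / 2) * ∫ ω, Real.exp (ξ ω ^ 2 / K ^ 2) ^ (1 / 2 : ℝ) ∂P :=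
          integral_const_mul _ _
      _ ≤ Real.exp (K ^ 2 * s ^ 2 / 2) * Real.exp (1 / 2) := by
          gcongr; exact hb1.trans (hpow _ (by norm_num))
      _ ≤ Real.exp (K ^ 2 * s ^ 2) := by
          rw [← Real.exp_add, Real.exp_le_exp]; linarith

end Subgaussian

/-! ### Sparse sub-Gaussian laws and their linear forms. -/

/-- A centered law on `ℝ` with variance `p` whose moment generating function is bounded by that of
`L s² · Bernoulli(p)`. -/
structure IsSparseSubgaussian (ν : Measure ℝ) (p L : ℝ) : Prop where
  memLp : MemLp id 2 ν
  mean : ∫ x, x ∂ν = 0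
  second_moment : ∫ x, x ^ 2 ∂ν = p
  integrable_exp : ∀ s : ℝ, Integrable (fun x => Real.exp (s * x)) ν
  integral_exp_le : ∀ s : ℝ, ∫ x, Real.exp (s * x) ∂ν ≤ 1 + p * (Real.exp (L * s ^ 2) - 1)

theorem IsSparsifiedPair.isSparseSubgaussian {Ω : Type*} [MeasurableSpace Ω] {P : Measure Ω}
    [IsProbabilityMeasure P] {p : unitInterval} {K K' : ℝ} {δ ξ : Ω → ℝ}
    (h : IsSparsifiedPair P p K δ ξ) (hK : K < K') (hK' : 0 < K') :
    IsSparseSubgaussian (P.map fun ω => δ ω * ξ ω) p (K' ^ 2) := by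
  have hδm : AEMeasurable δ P := h.bernoulli.aemeasurable
  have hξm := h.aemeasurable
  have hm : AEMeasurable (fun ω => δ ω * ξ ω) P := hδm.mul hξm
  have hδ : ∀ᵐ ω ∂P, δ ω = 1 ∨ δ ω = 0 := by
    rw [h.bernoulli.ae_iff (p := fun x : ℝ => x = 1 ∨ x = 0)
      (measurableSet_setOfPred.1 ((measurableSet_singleton (1 : ℝ)).union (measurableSet_singleton 0)))]
    rw [bernoulliMeasure_def, ae_add_measure_iff]
    constructor <;> refine Measure.ae_smul_measure ?_ _ <;> simp [ae_dirac_eq]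
  have hδi : ∫ ω, δ ω ∂P = p := by
    rw [h.bernoulli.integral_eq, integral_bernoulliMeasure]; simp
  have hδint : Integrable δ P := by
    refine Integrable.of_bound hδm.aestronglyMeasurable 1 ?_
    filter_upwards [hδ] with ω hω
    rcases hω with hω | hω <;> simp [hω]
  -- A non-integrable function has integral 0 by convention, so a second moment equal to 1 forces
  -- integrability.
  have hξ2 : Integrable (fun ω => ξ ω ^ 2) P := by
    by_contra hc
    have := h.second_moment
    rw [integral_undef hc] at this
    exact zero_ne_one this
  have hξL : MemLp ξ 2 P := (memLp_two_iff_integrable_sq hξm.aestronglyMeasurable).2 hξ2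
  have hlt : psiTwoNorm ξ P < ENNReal.ofReal K' :=
    h.psiTwoNorm_le.trans_lt ((ENNReal.ofReal_lt_ofReal_iff hK').2 hK)
  obtain ⟨he, he2⟩ := integral_exp_sq_le_of_psiTwoNorm_lt hξm hlt
  have hmgf := integral_exp_mul_le_of_integral_exp_sq_le hK' hξm h.centered he he2
  -- Since `δ` is almost surely 0 or 1, the exponential is affine in `δ`, and independence factors
  -- the expectation.
  have hexp : ∀ s : ℝ, (fun ω => Real.exp (s * (δ ω * ξ ω))) =ᵐ[P]
      fun ω => 1 + δ ω * (Real.exp (s * ξ ω) - 1) := by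
    intro s
    filter_upwards [hδ] with ω hω
    rcases hω with hω | hω <;> simp [hω]
  have hind : ∀ s : ℝ, IndepFun δ (fun ω => Real.exp (s * ξ ω) - 1) P := fun s =>
    h.indep.comp (φ := id) (ψ := fun x => Real.exp (s * x) - 1) measurable_id (by fun_prop)
  have hint : ∀ s : ℝ, Integrable (fun ω => δ ω * (Real.exp (s * ξ ω) - 1)) P := fun s =>
    (hind s).integrable_mul hδint ((hmgf s).1.sub (integrable_const 1))
  have hind2 : IndepFun δ (fun ω => ξ ω ^ 2) P :=
    h.indep.comp (φ := id) (ψ := fun x => x ^ 2) measurable_id (by fun_prop)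
  refine ⟨?_, ?_, ?_, ?_, ?_⟩
  · rw [memLp_map_measure_iff (by fun_prop) hm]
    refine hξL.of_le hm.aestronglyMeasurable ?_
    filter_upwards [hδ] with ω hω
    rcases hω with hω | hω <;> simp [hω]
  · rw [integral_map hm (by fun_prop), h.indep.integral_fun_mul_eq_mul_integral
      hδm.aestronglyMeasurable hξm.aestronglyMeasurable, h.centered, mul_zero]
  · rw [integral_map hm (by fun_prop)]
    have : (fun ω => (δ ω * ξ ω) ^ 2) =ᵐ[P] fun ω => δ ω * ξ ω ^ 2 := by
      filter_upwards [hδ] with ω hω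
      rcases hω with hω | hω <;> simp [hω]
    rw [integral_congr_ae this, hind2.integral_fun_mul_eq_mul_integral
      hδm.aestronglyMeasurable (hξm.pow_const 2).aestronglyMeasurable, h.second_moment, hδi,
      mul_one]
  · intro s
    rw [integrable_map_measure (by fun_prop) hm]
    exact ((integrable_const 1).add (hint s)).congr (hexp s).symm
  · intro s
    rw [integral_map hm (by fun_prop), integral_congr_ae (hexp s),
      integral_add (integrable_const 1) (hint s),
      (hind s).integral_fun_mul_eq_mul_integral hδm.aestronglyMeasurable
        ((hmgf s).1.sub (integrable_const 1)).aestronglyMeasurable,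
      integral_sub (hmgf s).1 (integrable_const 1), hδi]
    simp only [integral_const, probReal_univ, smul_eq_mul, mul_one]
    have := (hmgf s).2
    have := p.2.1
    gcongr

/-- With two factors the defect is `p (1 - p) (x - 1) (y - 1) ≥ 0`; induct. This keeps a single
factor `p` when the moment generating functions of independent coordinates are multiplied. -/
theorem prod_one_add_mul_sub_one_le {ι : Type*} (s : Finset ι) {p : ℝ} (h0 : 0 ≤ p) (h1 : p ≤ 1)
    {x : ι → ℝ} (hx : ∀ i, 1 ≤ x i) :
    ∏ i ∈ s, (1 + p * (x i - 1)) ≤ 1 + p * (∏ i ∈ s, x i - 1) := by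
  classical
  induction s using Finset.induction_on with
  | empty => simp
  | insert i s hi ih =>
    rw [Finset.prod_insert hi, Finset.prod_insert hi]
    have hy : 1 ≤ ∏ i ∈ s, x i := Finset.one_le_prod fun j _ => hx j
    have hxi := hx i
    have : 0 ≤ 1 + p * (x i - 1) := by
      have : 0 ≤ p * (x i - 1) := mul_nonneg h0 (by linarith)
      linarith
    refine (mul_le_mul_of_nonneg_left ih this).trans ?_
    have h3 : 0 ≤ p * (1 - p) * ((x i - 1) * (∏ i ∈ s, x i - 1)) :=
      mul_nonneg (mul_nonneg h0 (by linarith)) (mul_nonneg (by linarith) (by linarith))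
    linear_combination h3

theorem integral_exp_mul_dotProduct_le {k : ℕ} {ν : Measure ℝ} [IsProbabilityMeasure ν] {p L : ℝ}
    (hν : IsSparseSubgaussian ν p L) (h0 : 0 ≤ p) (h1 : p ≤ 1) (hL : 0 ≤ L) {u : Fin k → ℝ}
    (hu : u ⬝ᵥ u ≤ 1) (s : ℝ) :
    Integrable (fun x => Real.exp (s * (u ⬝ᵥ x))) (Measure.pi fun _ : Fin k => ν) ∧
      ∫ x, Real.exp (s * (u ⬝ᵥ x)) ∂(Measure.pi fun _ : Fin k => ν) ≤
        1 + p * (Real.exp (L * s ^ 2) - 1) := by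
  have he : (fun x : Fin k → ℝ => Real.exp (s * (u ⬝ᵥ x))) =
      fun x => ∏ a, Real.exp (s * u a * x a) := by
    ext x
    rw [← Real.exp_sum, dotProduct, Finset.mul_sum]
    simp only [mul_assoc]
  rw [he]
  constructor
  · exact Integrable.fintype_prod (f := fun a x => Real.exp (s * u a * x))
      fun a => hν.integrable_exp (s * u a)
  · rw [integral_fintype_prod_eq_prod (fun a x => Real.exp (s * u a * x))]
    calc ∏ a, ∫ x, Real.exp (s * u a * x) ∂ν
        ≤ ∏ a, (1 + p * (Real.exp (L * (s * u a) ^ 2) - 1)) :=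
          Finset.prod_le_prod (fun a _ => integral_nonneg fun x => (Real.exp_pos _).le)
            fun a _ => hν.integral_exp_le _
      _ ≤ 1 + p * (∏ a, Real.exp (L * (s * u a) ^ 2) - 1) :=
          prod_one_add_mul_sub_one_le _ h0 h1 fun a => Real.one_le_exp (by positivity)
      _ ≤ _ := by
          rw [← Real.exp_sum]
          have : ∑ a, L * (s * u a) ^ 2 = L * s ^ 2 * (u ⬝ᵥ u) := by
            rw [dotProduct, Finset.mul_sum]
            exact Finset.sum_congr rfl fun a _ => by ring
          rw [this]
          have h2 : L * s ^ 2 * (u ⬝ᵥ u) ≤ L * s ^ 2 :=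
            mul_le_of_le_one_right (by positivity) hu
          gcongr

/-! ### Gaussian linearisation of the square. -/

theorem lintegral_exp_mul_gaussianReal (t : ℝ) :
    ∫⁻ g, ENNReal.ofReal (Real.exp (t * g)) ∂(gaussianReal 0 1) =
      ENNReal.ofReal (Real.exp (t ^ 2 / 2)) := by
  rw [← ofReal_integral_eq_lintegral_ofReal (integrable_exp_mul_gaussianReal t)
    (ae_of_all _ fun _ => (Real.exp_pos _).le)]
  have := congrFun (mgf_fun_id_gaussianReal (μ := 0) (v := 1)) t
  simp only [mgf] at this
  rw [this]
  simp

/-- The value is `(1 - 2 · 3/8)^{-1/2}`; the coefficient `3/8` is chosen to make it exactly 2. -/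
theorem lintegral_exp_sq_gaussianReal :
    ∫⁻ g, ENNReal.ofReal (Real.exp (3 / 8 * g ^ 2)) ∂(gaussianReal 0 1) = 2 := by
  rw [gaussianReal_of_var_ne_zero _ one_ne_zero,
    lintegral_withDensity_eq_lintegral_mul _ (measurable_gaussianPDF _ _) (by fun_prop)]
  have : (fun g : ℝ => (gaussianPDF 0 1 * fun g => ENNReal.ofReal (Real.exp (3 / 8 * g ^ 2))) g) =
      fun g => ENNReal.ofReal ((√(2 * Real.pi))⁻¹ * Real.exp (-(1 / 8) * g ^ 2)) := by
    ext g
    simp only [Pi.mul_apply, gaussianPDF, gaussianPDFReal]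
    rw [← ENNReal.ofReal_mul (by positivity), mul_assoc, ← Real.exp_add]
    congr 3
    · simp
    · simp; ring
  rw [this, ← ofReal_integral_eq_lintegral_ofReal
    ((integrable_exp_neg_mul_sq (by norm_num)).const_mul _) (ae_of_all _ fun _ => by positivity),
    integral_const_mul, integral_gaussian]
  have : √(Real.pi / (1 / 8)) = 2 * √(2 * Real.pi) := by
    rw [show Real.pi / (1 / 8) = 2 ^ 2 * (2 * Real.pi) by ring, Real.sqrt_mul (by norm_num),
      Real.sqrt_sq (by norm_num)]
  rw [this]
  have : √(2 * Real.pi) ≠ 0 := by positivity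
  rw [show (√(2 * Real.pi))⁻¹ * (2 * √(2 * Real.pi)) = 2 by field_simp]
  simp

/-- Write `exp (t² A² / 2)` as the mean of `exp (t A g)` over a standard Gaussian `g`, and swap the
integrals. The mgf bound at `s = t g` then integrates to `(1 - p) + 2 p`. -/
theorem integral_exp_sq_le_of_integral_exp_le {Ω : Type*} [MeasurableSpace Ω] {P : Measure Ω}
    [IsProbabilityMeasure P] {A : Ω → ℝ} (hA : AEMeasurable A P) {p L : ℝ} (h0 : 0 ≤ p)
    (h1 : p ≤ 1) (hL : 0 < L)
    (hA' : ∀ s : ℝ, Integrable (fun ω => Real.exp (s * A ω)) P ∧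
      ∫ ω, Real.exp (s * A ω) ∂P ≤ 1 + p * (Real.exp (L * s ^ 2) - 1)) :
    Integrable (fun ω => Real.exp (3 / (16 * L) * A ω ^ 2)) P ∧
      ∫ ω, Real.exp (3 / (16 * L) * A ω ^ 2) ∂P ≤ 1 + p := by
  -- Chosen so that `L (t g)² = 3/8 g²`.
  set t : ℝ := √(3 / (8 * L)) with ht
  have ht2 : t ^ 2 = 3 / (8 * L) := Real.sq_sqrt (by positivity)
  have key : ∫⁻ ω, ENNReal.ofReal (Real.exp (3 / (16 * L) * A ω ^ 2)) ∂P ≤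
      ENNReal.ofReal (1 + p) := by
    calc ∫⁻ ω, ENNReal.ofReal (Real.exp (3 / (16 * L) * A ω ^ 2)) ∂P
        = ∫⁻ ω, ∫⁻ g, ENNReal.ofReal (Real.exp ((t * A ω) * g)) ∂(gaussianReal 0 1) ∂P := by
          refine lintegral_congr fun ω => ?_
          rw [lintegral_exp_mul_gaussianReal, mul_pow, ht2]
          congr 2
          field_simp
          ring
      _ = ∫⁻ g, ∫⁻ ω, ENNReal.ofReal (Real.exp ((t * A ω) * g)) ∂P ∂(gaussianReal 0 1) := by
          refine lintegral_lintegral_swap ?_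
          have : AEMeasurable (fun z : Ω × ℝ => A z.1) (P.prod (gaussianReal 0 1)) :=
            hA.comp_fst
          exact (((this.const_mul t).mul measurable_snd.aemeasurable).exp).ennreal_ofReal
      _ ≤ ∫⁻ g, (ENNReal.ofReal (1 - p) + ENNReal.ofReal p *
            ENNReal.ofReal (Real.exp (3 / 8 * g ^ 2))) ∂(gaussianReal 0 1) := by
          refine lintegral_mono fun g => ?_
          have h3 : ∀ ω, t * A ω * g = (t * g) * A ω := fun ω => by ring
          simp only [h3]
          rw [← ofReal_integral_eq_lintegral_ofReal (hA' (t * g)).1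
            (ae_of_all _ fun _ => (Real.exp_pos _).le), ← ENNReal.ofReal_mul h0,
            ← ENNReal.ofReal_add (by linarith) (by positivity)]
          refine ENNReal.ofReal_le_ofReal ((hA' (t * g)).2.trans (le_of_eq ?_))
          have : L * (t * g) ^ 2 = 3 / 8 * g ^ 2 := by
            rw [mul_pow, ht2]; field_simp
          rw [this]; ring
      _ = ENNReal.ofReal (1 + p) := by
          rw [lintegral_add_left (by fun_prop), lintegral_const_mul _ (by fun_prop),
            lintegral_exp_sq_gaussianReal]
          simp only [lintegral_const, measure_univ, mul_one]
          rw [show (2 : ℝ≥0∞) = ENNReal.ofReal 2 by simp, ← ENNReal.ofReal_mul h0,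
            ← ENNReal.ofReal_add (by linarith) (by positivity)]
          congr 1; ring
  have hm : AEStronglyMeasurable (fun ω => Real.exp (3 / (16 * L) * A ω ^ 2)) P :=
    ((hA.pow_const 2).const_mul _).exp.aestronglyMeasurable
  constructor
  · refine ⟨hm, ?_⟩
    rw [hasFiniteIntegral_iff_ofReal (ae_of_all _ fun ω => (Real.exp_pos _).le)]
    exact key.trans_lt (by simp)
  · rw [integral_eq_lintegral_of_nonneg_ae (ae_of_all _ fun ω => (Real.exp_pos _).le) hm]
    exact ENNReal.toReal_le_of_le_ofReal (by positivity) key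

/-! ### Moments of a product of two linear forms in one column. -/

section Column

variable {k : ℕ} {ν : Measure ℝ} [IsProbabilityMeasure ν] {p L : ℝ}

theorem IsSparseSubgaussian.memLp_eval (hν : IsSparseSubgaussian ν p L) (a : Fin k) :
    MemLp (fun x : Fin k → ℝ => x a) 2 (Measure.pi fun _ : Fin k => ν) :=
  hν.memLp.comp_measurePreserving (measurePreserving_eval (fun _ : Fin k => ν) a)

theorem IsSparseSubgaussian.integral_eval_mul_eval (hν : IsSparseSubgaussian ν p L)
    (a b : Fin k) :
    ∫ x, x a * x b ∂(Measure.pi fun _ : Fin k => ν) = if a = b then p else 0 := by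
  split_ifs with h
  · subst h
    have := (measurePreserving_eval (fun _ : Fin k => ν) a).map_eq
    rw [← hν.second_moment]
    conv_rhs => rw [← this, integral_map (measurable_pi_apply a).aemeasurable (by fun_prop)]
    simp [sq]
  · have hi : iIndepFun (fun (i : Fin k) (x : Fin k → ℝ) => x i) (Measure.pi fun _ : Fin k => ν) :=
      iIndepFun_pi (X := fun _ x => x) fun _ => aemeasurable_id
    have h0 : ∫ x, x a ∂(Measure.pi fun _ : Fin k => ν) = 0 :=
      (measurePreserving_eval (fun _ : Fin k => ν) a).hasLaw.integral_eq.trans hν.mean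
    rw [(hi.indepFun h).integral_fun_mul_eq_mul_integral
      (measurable_pi_apply a).aestronglyMeasurable (measurable_pi_apply b).aestronglyMeasurable,
      h0, zero_mul]

theorem IsSparseSubgaussian.integral_dotProduct_mul_dotProduct (hν : IsSparseSubgaussian ν p L)
    (u v : Fin k → ℝ) :
    Integrable (fun x => (u ⬝ᵥ x) * (v ⬝ᵥ x)) (Measure.pi fun _ : Fin k => ν) ∧
      ∫ x, (u ⬝ᵥ x) * (v ⬝ᵥ x) ∂(Measure.pi fun _ : Fin k => ν) = p * (u ⬝ᵥ v) := by
  have he : (fun x : Fin k → ℝ => (u ⬝ᵥ x) * (v ⬝ᵥ x)) =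
      fun x => ∑ a, ∑ b, u a * v b * (x a * x b) := by
    ext x
    simp only [dotProduct, Finset.sum_mul_sum]
    exact Finset.sum_congr rfl fun a _ => Finset.sum_congr rfl fun b _ => by ring
  have hi : ∀ a b : Fin k, Integrable (fun x : Fin k → ℝ => u a * v b * (x a * x b))
      (Measure.pi fun _ : Fin k => ν) := fun a b =>
    ((hν.memLp_eval a).integrable_mul (hν.memLp_eval b)).const_mul _
  rw [he]
  refine ⟨integrable_finsetSum _ fun a _ => integrable_finsetSum _ fun b _ => hi a b, ?_⟩
  rw [integral_finsetSum _ fun a _ => integrable_finsetSum _ fun b _ => hi a b]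
  simp_rw [integral_finsetSum _ fun b _ => hi _ b, integral_const_mul,
    hν.integral_eval_mul_eval]
  simp [dotProduct, Finset.mul_sum, mul_comm]

/-- AM-GM replaces `|a b|` by `(a² + b²) / 2`, and `exp` of a mean is at most the mean of the
`exp`s. The `- 2` is kept because its expectation leaves only `2 p`. -/
theorem sq_mul_exp_abs_mul_le {c lam a b : ℝ} (hc : 0 < c) (hlam : |lam| ≤ c / 2) :
    (a * b) ^ 2 * Real.exp |lam * (a * b)| ≤
      4 / c ^ 2 * (Real.exp (c * a ^ 2) + Real.exp (c * b ^ 2) - 2) := by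
  set x : ℝ := c * ((a ^ 2 + b ^ 2) / 2) with hx
  have hx0 : 0 ≤ x := by positivity
  have hab : |a * b| ≤ (a ^ 2 + b ^ 2) / 2 := by
    rw [abs_mul]; nlinarith [sq_nonneg (|a| - |b|), sq_abs a, sq_abs b]
  have h1 : (a * b) ^ 2 ≤ x ^ 2 / c ^ 2 := by
    have : x ^ 2 / c ^ 2 = ((a ^ 2 + b ^ 2) / 2) ^ 2 := by rw [hx]; field_simp
    rw [this, ← sq_abs]
    gcongr
  have h2 : |lam * (a * b)| ≤ x / 2 := by
    rw [abs_mul, hx]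
    calc |lam| * |a * b| ≤ c / 2 * ((a ^ 2 + b ^ 2) / 2) := by gcongr
      _ = _ := by ring
  have h3 : Real.exp x ≤ (Real.exp (c * a ^ 2) + Real.exp (c * b ^ 2)) / 2 := by
    have e1 : Real.exp (c * a ^ 2) = Real.exp (c * a ^ 2 / 2) ^ 2 := by
      rw [sq (Real.exp _), ← Real.exp_add]; ring_nf
    have e2 : Real.exp (c * b ^ 2) = Real.exp (c * b ^ 2 / 2) ^ 2 := by
      rw [sq (Real.exp _), ← Real.exp_add]; ring_nf
    have e3 : Real.exp x = Real.exp (c * a ^ 2 / 2) * Real.exp (c * b ^ 2 / 2) := by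
      rw [← Real.exp_add, hx]; ring_nf
    rw [e1, e2, e3]
    nlinarith [sq_nonneg (Real.exp (c * a ^ 2 / 2) - Real.exp (c * b ^ 2 / 2))]
  calc (a * b) ^ 2 * Real.exp |lam * (a * b)|
      ≤ x ^ 2 / c ^ 2 * Real.exp (x / 2) := by gcongr
    _ = 1 / c ^ 2 * (x ^ 2 * Real.exp (x / 2)) := by ring
    _ ≤ 1 / c ^ 2 * (8 * (Real.exp x - 1)) :=
        mul_le_mul_of_nonneg_left (sq_mul_exp_half_le hx0) (by positivity)
    _ ≤ 1 / c ^ 2 * (8 * ((Real.exp (c * a ^ 2) + Real.exp (c * b ^ 2)) / 2 - 1)) := by gcongr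
    _ = _ := by ring

/-- Second-order Taylor bound: the quadratic remainder integrates to at most `lam² · 4 / c² · 2 p`.
-/
theorem integral_exp_mul_mul_le {Ω : Type*} [MeasurableSpace Ω] {P : Measure Ω}
    [IsProbabilityMeasure P] {A B : Ω → ℝ} (hA : AEMeasurable A P) (hB : AEMeasurable B P)
    {c : ℝ} (hc : 0 < c)
    (hAi : Integrable (fun ω => Real.exp (c * A ω ^ 2)) P)
    (hBi : Integrable (fun ω => Real.exp (c * B ω ^ 2)) P)
    (hAe : ∫ ω, Real.exp (c * A ω ^ 2) ∂P ≤ 1 + p)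
    (hBe : ∫ ω, Real.exp (c * B ω ^ 2) ∂P ≤ 1 + p)
    (hABi : Integrable (fun ω => A ω * B ω) P) {lam : ℝ} (hlam : |lam| ≤ c / 2) :
    Integrable (fun ω => Real.exp (lam * (A ω * B ω))) P ∧
      ∫ ω, Real.exp (lam * (A ω * B ω)) ∂P ≤
        Real.exp (lam * ∫ ω, A ω * B ω ∂P + lam ^ 2 * (8 / c ^ 2 * p)) := by
  have hAB : Integrable (fun ω => lam ^ 2 * (4 / c ^ 2 *
      (Real.exp (c * A ω ^ 2) + Real.exp (c * B ω ^ 2) - 2))) P :=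
    (((hAi.add hBi).sub (integrable_const 2)).const_mul _).const_mul _
  have hmaj : Integrable (fun ω => 1 + lam * (A ω * B ω) + lam ^ 2 * (4 / c ^ 2 *
      (Real.exp (c * A ω ^ 2) + Real.exp (c * B ω ^ 2) - 2))) P :=
    ((integrable_const 1).add (hABi.const_mul lam)).add hAB
  have hle : ∀ ω, Real.exp (lam * (A ω * B ω)) ≤ 1 + lam * (A ω * B ω) + lam ^ 2 * (4 / c ^ 2 *
      (Real.exp (c * A ω ^ 2) + Real.exp (c * B ω ^ 2) - 2)) := fun ω => by
    have h1 := exp_le_one_add_add_sq_mul_exp_abs (lam * (A ω * B ω))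
    have h2 := mul_le_mul_of_nonneg_left
      (sq_mul_exp_abs_mul_le (a := A ω) (b := B ω) hc hlam) (sq_nonneg lam)
    rw [mul_pow lam] at h1
    linarith
  have hint : Integrable (fun ω => Real.exp (lam * (A ω * B ω))) P := by
    refine hmaj.mono' ((hA.mul hB).const_mul lam).exp.aestronglyMeasurable
      (ae_of_all _ fun ω => ?_)
    rw [Real.norm_of_nonneg (Real.exp_pos _).le]
    exact hle ω
  refine ⟨hint, ?_⟩
  calc ∫ ω, Real.exp (lam * (A ω * B ω)) ∂P
      ≤ ∫ ω, (1 + lam * (A ω * B ω) + lam ^ 2 * (4 / c ^ 2 *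
          (Real.exp (c * A ω ^ 2) + Real.exp (c * B ω ^ 2) - 2))) ∂P :=
        integral_mono hint hmaj hle
    _ = 1 + lam * (∫ ω, A ω * B ω ∂P) + lam ^ 2 * (4 / c ^ 2 *
          (∫ ω, Real.exp (c * A ω ^ 2) ∂P + ∫ ω, Real.exp (c * B ω ^ 2) ∂P - 2)) := by
        rw [integral_add (f := fun ω => 1 + lam * (A ω * B ω))
            ((integrable_const 1).add (hABi.const_mul lam)) hAB,
          integral_add (integrable_const 1) (hABi.const_mul lam), integral_const_mul,
          integral_const_mul, integral_const_mul,
          integral_sub (f := fun ω => Real.exp (c * A ω ^ 2) + Real.exp (c * B ω ^ 2))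
            (hAi.add hBi) (integrable_const 2), integral_add hAi hBi]
        simp
    _ ≤ 1 + lam * (∫ ω, A ω * B ω ∂P) + lam ^ 2 * (4 / c ^ 2 * ((1 + p) + (1 + p) - 2)) := by
        gcongr
    _ = lam * (∫ ω, A ω * B ω ∂P) + lam ^ 2 * (8 / c ^ 2 * p) + 1 := by ring
    _ ≤ _ := Real.add_one_le_exp _

theorem IsSparseSubgaussian.integral_exp_mul_dotProduct_mul_dotProduct_le
    (hν : IsSparseSubgaussian ν p L) (h0 : 0 ≤ p) (h1 : p ≤ 1) (hL : 0 < L) {u v : Fin k → ℝ}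
    (hu : u ⬝ᵥ u ≤ 1) (hv : v ⬝ᵥ v ≤ 1) {lam : ℝ} (hlam : |lam| ≤ 3 / (16 * L) / 2) :
    Integrable (fun x => Real.exp (lam * ((u ⬝ᵥ x) * (v ⬝ᵥ x))))
        (Measure.pi fun _ : Fin k => ν) ∧
      ∫ x, Real.exp (lam * ((u ⬝ᵥ x) * (v ⬝ᵥ x))) ∂(Measure.pi fun _ : Fin k => ν) ≤
        Real.exp (lam * (p * (u ⬝ᵥ v)) + lam ^ 2 * (8 / (3 / (16 * L)) ^ 2 * p)) := by
  have hm : ∀ w : Fin k → ℝ, AEMeasurable (fun x : Fin k → ℝ => w ⬝ᵥ x)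
      (Measure.pi fun _ : Fin k => ν) := fun w => by
    unfold dotProduct
    exact (Finset.measurable_sum _ fun a _ => by fun_prop).aemeasurable
  obtain ⟨hui, hue⟩ := integral_exp_sq_le_of_integral_exp_le (hm u) h0 h1 hL
    (integral_exp_mul_dotProduct_le hν h0 h1 hL.le hu)
  obtain ⟨hvi, hve⟩ := integral_exp_sq_le_of_integral_exp_le (hm v) h0 h1 hL
    (integral_exp_mul_dotProduct_le hν h0 h1 hL.le hv)
  obtain ⟨huv, huve⟩ := hν.integral_dotProduct_mul_dotProduct u v
  rw [← huve]
  exact integral_exp_mul_mul_le (hm u) (hm v) (by positivity) hui hvi hue hve huv hlam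

end Column

/-! ### Bernstein tail for the sum over columns. -/

section Tail

variable {k r : ℕ} {ν : Measure ℝ} [IsProbabilityMeasure ν] {p L : ℝ}

theorem IsSparseSubgaussian.measure_sum_ge_le_exp
    (hν : IsSparseSubgaussian ν p L) (h0 : 0 ≤ p) (h1 : p ≤ 1) (hL : 0 < L) {u v : Fin k → ℝ}
    (hu : u ⬝ᵥ u ≤ 1) (hv : v ⬝ᵥ v ≤ 1) (ε : ℝ) {lam : ℝ} (hlam0 : 0 ≤ lam)
    (hlam : lam ≤ 3 / (16 * L) / 2) :
    (Measure.pi fun _ : Fin r => Measure.pi fun _ : Fin k => ν).real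
        {x | r * (p * (u ⬝ᵥ v) + ε) ≤ ∑ b, (u ⬝ᵥ x b) * (v ⬝ᵥ x b)} ≤
      Real.exp (-(r * (lam * ε - lam ^ 2 * (8 / (3 / (16 * L)) ^ 2 * p)))) := by
  obtain ⟨hi, he⟩ := hν.integral_exp_mul_dotProduct_mul_dotProduct_le h0 h1 hL hu hv
    (lam := lam) (by rwa [abs_of_nonneg hlam0])
  have hexp : (fun x : Fin r → Fin k → ℝ =>
      Real.exp (lam * ∑ b, (u ⬝ᵥ x b) * (v ⬝ᵥ x b))) =
      fun x => ∏ b, Real.exp (lam * ((u ⬝ᵥ x b) * (v ⬝ᵥ x b))) := by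
    ext x
    rw [← Real.exp_sum, Finset.mul_sum]
  refine (measure_ge_le_exp_mul_mgf (t := lam) _ hlam0 ?_).trans ?_
  · rw [hexp]
    exact Integrable.fintype_prod
      (f := fun (_ : Fin r) x => Real.exp (lam * ((u ⬝ᵥ x) * (v ⬝ᵥ x)))) fun _ => hi
  · rw [mgf, hexp, integral_fintype_prod_eq_prod
      (fun (_ : Fin r) x => Real.exp (lam * ((u ⬝ᵥ x) * (v ⬝ᵥ x)))), Finset.prod_const,
      Finset.card_univ, Fintype.card_fin]
    refine (mul_le_mul_of_nonneg_left (pow_le_pow_left₀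
      (integral_nonneg fun _ => (Real.exp_pos _).le) he r) (Real.exp_pos _).le).trans (le_of_eq ?_)
    rw [← Real.exp_nat_mul, ← Real.exp_add]
    congr 1
    ring

theorem exists_pos_le_exponent {c D p ε ℓ r : ℝ} (hc : 0 < c) (hD : 0 < D) (hp : 0 < p)
    (hε : 0 < ε) (hr0 : 0 ≤ r)
    (hr : 4 / min c (1 / (2 * D)) * ℓ * max (p / ε ^ 2) (1 / ε) ≤ r) :
    ∃ lam : ℝ, 0 ≤ lam ∧ lam ≤ c ∧ 2 * ℓ ≤ r * (lam * ε - lam ^ 2 * (D * p)) := by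
  set M : ℝ := min c (1 / (2 * D)) with hM
  have hM0 : 0 < M := by positivity
  -- The maximiser of the quadratic exponent, capped at the admissible `c`. Either way the exponent
  -- is at least `r lam ε / 2`; the cap corresponds to the `1 / ε` regime, the free optimum to `p /
  -- ε²`.
  set lam : ℝ := min c (ε / (2 * D * p)) with hl
  have hl0 : 0 < lam := by positivity
  have h1 : lam * (D * p) ≤ ε / 2 := by
    have := min_le_right c (ε / (2 * D * p))
    rw [← hl] at this
    calc lam * (D * p) ≤ ε / (2 * D * p) * (D * p) := by gcongr
      _ = ε / 2 := by field_simp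
  refine ⟨lam, hl0.le, min_le_left _ _, ?_⟩
  set m : ℝ := max (p / ε ^ 2) (1 / ε) with hm
  have hm0 : 0 < m := by positivity
  have h2 : M ≤ lam * ε * m := by
    rcases le_total c (ε / (2 * D * p)) with h | h
    · have : lam = c := min_eq_left h
      rw [this]
      calc M ≤ c := min_le_left _ _
        _ = c * ε * (1 / ε) := by field_simp
        _ ≤ c * ε * m := by gcongr; exact le_max_right _ _
    · have : lam = ε / (2 * D * p) := min_eq_right h
      rw [this]
      calc M ≤ 1 / (2 * D) := min_le_right _ _
        _ = ε / (2 * D * p) * ε * (p / ε ^ 2) := by field_simp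
        _ ≤ _ := by gcongr; exact le_max_left _ _
  rcases le_total ℓ 0 with hℓ | hℓ
  · have : 0 ≤ r * (lam * ε - lam ^ 2 * (D * p)) := by
      refine mul_nonneg hr0 ?_
      nlinarith
    linarith
  calc 2 * ℓ = 4 / M * ℓ * (M / 2) := by field_simp; ring
    _ ≤ 4 / M * ℓ * (lam * ε * m / 2) := by gcongr
    _ = (4 / M * ℓ * m) * (lam * ε / 2) := by ring
    _ ≤ r * (lam * ε / 2) := by gcongr
    _ ≤ r * (lam * ε - lam ^ 2 * (D * p)) := by
        gcongr
        nlinarith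

theorem IsSparseSubgaussian.measure_abs_gt_le (hν : IsSparseSubgaussian ν p L) (h0 : 0 < p)
    (h1 : p ≤ 1) (hL : 0 < L) {ε ℓ : ℝ} (hε : 0 < ε)
    (hr : 4 / min (3 / (16 * L) / 2) (1 / (2 * (8 / (3 / (16 * L)) ^ 2))) * ℓ *
      max (p / ε ^ 2) (1 / ε) ≤ r) (u v : Fin k → ℝ) :
    (Measure.pi fun _ : Fin r => Measure.pi fun _ : Fin k => ν).real
        {x | r * (ε * (√(u ⬝ᵥ u) * √(v ⬝ᵥ v))) <
          |∑ b, (u ⬝ᵥ x b) * (v ⬝ᵥ x b) - r * (p * (u ⬝ᵥ v))|} ≤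
      2 * Real.exp (-(2 * ℓ)) := by
  have hnn : ∀ w : Fin k → ℝ, 0 ≤ w ⬝ᵥ w := fun w =>
    Finset.sum_nonneg fun _ _ => mul_self_nonneg _
  -- The event is a strict inequality, so it is empty for a zero vector; otherwise normalise.
  rcases eq_or_ne u 0 with rfl | hu
  · simp only [zero_dotProduct]
    simp; positivity
  rcases eq_or_ne v 0 with rfl | hv
  · simp only [zero_dotProduct, dotProduct_zero]
    simp; positivity
  have hpos : ∀ w : Fin k → ℝ, w ≠ 0 → 0 < √(w ⬝ᵥ w) := fun w hw =>
    Real.sqrt_pos.2 ((hnn w).lt_of_ne fun h => hw (dotProduct_self_eq_zero.1 h.symm))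
  set a := √(u ⬝ᵥ u) with ha
  set b := √(v ⬝ᵥ v) with hb
  have ha0 : 0 < a := hpos u hu
  have hb0 : 0 < b := hpos v hv
  have hua : u ⬝ᵥ u = a ^ 2 := (Real.sq_sqrt (hnn u)).symm
  have hvb : v ⬝ᵥ v = b ^ 2 := (Real.sq_sqrt (hnn v)).symm
  obtain ⟨lam, hl0, hlc, hl⟩ := exists_pos_le_exponent (c := 3 / (16 * L) / 2)
    (D := 8 / (3 / (16 * L)) ^ 2) (by positivity) (by positivity) h0 hε (Nat.cast_nonneg r) hr
  have hu1 : (a⁻¹ • u) ⬝ᵥ (a⁻¹ • u) ≤ 1 := by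
    rw [smul_dotProduct, dotProduct_smul, hua]
    simp only [smul_eq_mul]
    exact le_of_eq (by field_simp)
  have hu2 : (-(a⁻¹ • u)) ⬝ᵥ (-(a⁻¹ • u)) ≤ 1 := by simpa using hu1
  have hv1 : (b⁻¹ • v) ⬝ᵥ (b⁻¹ • v) ≤ 1 := by
    rw [smul_dotProduct, dotProduct_smul, hvb]
    simp only [smul_eq_mul]
    exact le_of_eq (by field_simp)
  have e1 := hν.measure_sum_ge_le_exp (r := r) h0.le h1 hL hu1 hv1 ε hl0 hlc
  -- The lower tail is the upper tail for `-u`.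
  have e2 := hν.measure_sum_ge_le_exp (r := r) h0.le h1 hL hu2 hv1 ε hl0 hlc
  have e3 : Real.exp (-(r * (lam * ε - lam ^ 2 * (8 / (3 / (16 * L)) ^ 2 * p)))) ≤
      Real.exp (-(2 * ℓ)) := Real.exp_le_exp.2 (neg_le_neg hl)
  have e4 := (measureReal_union_le _ _).trans (add_le_add (e1.trans e3) (e2.trans e3))
  rw [← two_mul] at e4
  refine (measureReal_mono ?_ (measure_ne_top _ _)).trans e4
  intro x hx
  simp only [Set.mem_ofPred_eq, Set.mem_union, smul_dotProduct, dotProduct_smul, smul_eq_mul,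
    neg_dotProduct] at hx ⊢
  have hs : ∑ i, a⁻¹ * (u ⬝ᵥ x i) * (b⁻¹ * (v ⬝ᵥ x i)) =
      (a * b)⁻¹ * ∑ i, (u ⬝ᵥ x i) * (v ⬝ᵥ x i) := by
    rw [Finset.mul_sum]
    exact Finset.sum_congr rfl fun i _ => by rw [mul_inv]; ring
  have hs' : ∑ i, -(a⁻¹ * (u ⬝ᵥ x i)) * (b⁻¹ * (v ⬝ᵥ x i)) =
      -((a * b)⁻¹ * ∑ i, (u ⬝ᵥ x i) * (v ⬝ᵥ x i)) := by
    rw [← hs, ← Finset.sum_neg_distrib]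
    exact Finset.sum_congr rfl fun i _ => by ring
  rw [hs, hs']
  have hab : 0 < a * b := mul_pos ha0 hb0
  rcases lt_abs.1 hx with h | h
  · left
    rw [inv_mul_eq_div (a * b), le_div_iff₀ hab]
    have : (r * (p * (b⁻¹ * (a⁻¹ * (u ⬝ᵥ v))) + ε)) * (a * b) =
        r * (p * (u ⬝ᵥ v)) + r * (ε * (a * b)) := by field_simp
    linarith
  · right
    rw [inv_mul_eq_div (a * b), ← neg_div, le_div_iff₀ hab]
    have : (r * (p * (b⁻¹ * -(a⁻¹ * (u ⬝ᵥ v))) + ε)) * (a * b) =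
        -(r * (p * (u ⬝ᵥ v))) + r * (ε * (a * b)) := by field_simp
    linarith

end Tail

/-! ### The law of the sketch as a product over columns. -/

/-- Both laws become the flat product over `κ × ι` once the indices are uncurried and swapped. -/
theorem map_curry_eq_pi_pi {Ω ι κ : Type*} [MeasurableSpace Ω] [Fintype ι] [Fintype κ]
    {P : Measure Ω} {Z : κ × ι → Ω → ℝ} (hZ : iIndepFun Z P) (hm : ∀ i, AEMeasurable (Z i) P)
    {ν : Measure ℝ} [IsProbabilityMeasure ν] (hν : ∀ i, P.map (Z i) = ν) :
    P.map (fun ω (b : ι) (a : κ) => Z (a, b) ω) =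
      Measure.pi fun _ : ι => Measure.pi fun _ : κ => ν := by
  have h1 : P.map (fun ω i => Z i ω) = Measure.pi fun _ : κ × ι => ν := by
    rw [hZ.map_fun_eq_pi_map hm]
    simp_rw [hν]
  set PP := Measure.pi fun _ : ι => Measure.pi fun _ : κ => ν with hPP
  have hcoord : ∀ b, PP.map (fun x : ι → κ → ℝ => x b) = Measure.pi fun _ : κ => ν := fun b =>
    (measurePreserving_eval (fun _ : ι => Measure.pi fun _ : κ => ν) b).map_eq
  have hrow : iIndepFun (fun (a : κ) (y : κ → ℝ) => y a) (Measure.pi fun _ : κ => ν) :=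
    iIndepFun_pi (X := fun _ x => x) fun _ => aemeasurable_id
  have hi : iIndepFun (fun (p : ι × κ) (x : ι → κ → ℝ) => x p.1 p.2) PP := by
    refine iIndepFun_uncurry' (X := fun b a (x : ι → κ → ℝ) => x b a) (fun b a => by fun_prop)
      ?_ fun b => ?_
    · exact iIndepFun_pi (X := fun _ x => x) fun _ => aemeasurable_id
    · rw [iIndepFun_iff_map_fun_eq_pi_map fun a =>
        (by fun_prop : Measurable fun x : ι → κ → ℝ => x b a).aemeasurable]
      have h2 : ∀ a, PP.map (fun x : ι → κ → ℝ => x b a) = ν := fun a => by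
        have : (fun x : ι → κ → ℝ => x b a) = (fun y : κ → ℝ => y a) ∘ fun x => x b := rfl
        rw [this, ← Measure.map_map (by fun_prop) (by fun_prop), hcoord]
        exact (measurePreserving_eval (fun _ : κ => ν) a).map_eq
      simp_rw [h2]
      exact hcoord b
  have hlaw : ∀ p : ι × κ, PP.map (fun x : ι → κ → ℝ => x p.1 p.2) = ν := fun p => by
    have : (fun x : ι → κ → ℝ => x p.1 p.2) = (fun y : κ → ℝ => y p.2) ∘ fun x => x p.1 := rfl
    rw [this, ← Measure.map_map (by fun_prop) (by fun_prop), hcoord]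
    exact (measurePreserving_eval (fun _ : κ => ν) p.2).map_eq
  have hi' := hi.precomp (g := (Prod.swap : κ × ι → ι × κ)) Prod.swap_injective
  have h3 : PP.map (fun x (p : κ × ι) => x p.2 p.1) = Measure.pi fun _ : κ × ι => ν := by
    have := hi'.map_fun_eq_pi_map fun i : κ × ι =>
      (by fun_prop : Measurable fun x : ι → κ → ℝ => x i.2 i.1).aemeasurable
    refine this.trans ?_
    congr 1
    ext1 i
    exact hlaw i.swap
  have hc : Measurable fun (y : κ × ι → ℝ) (b : ι) (a : κ) => y (a, b) := by fun_prop
  have h4 : (fun ω (b : ι) (a : κ) => Z (a, b) ω) =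
      (fun (y : κ × ι → ℝ) (b : ι) (a : κ) => y (a, b)) ∘ fun ω i => Z i ω := rfl
  rw [h4, ← AEMeasurable.map_map_of_aemeasurable hc.aemeasurable (aemeasurable_pi_lambda _ hm), h1,
    ← h3, Measure.map_map hc (by fun_prop)]
  exact Measure.map_id

theorem IsSparsifiedSketch.map_eq_pi_pi {Ω Ω₀ : Type*} [MeasurableSpace Ω] [MeasurableSpace Ω₀]
    {P : Measure Ω} {P₀ : Measure Ω₀} [IsProbabilityMeasure P₀] {k r : ℕ} (hr : 0 < r)
    {δ ξ : Ω₀ → ℝ} (hm : AEMeasurable (fun ω => δ ω * ξ ω) P₀)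
    {Q : Ω → Matrix (Fin k) (Fin r) ℝ} (h : IsSparsifiedSketch P P₀ δ ξ Q) :
    AEMeasurable (fun ω (b : Fin r) (a : Fin k) => √(r : ℝ) * Q ω a b) P ∧
    P.map (fun ω (b : Fin r) (a : Fin k) => √(r : ℝ) * Q ω a b) =
      Measure.pi fun _ : Fin r => Measure.pi fun _ : Fin k => P₀.map fun ω => δ ω * ξ ω := by
  have : IsProbabilityMeasure (P₀.map fun ω => δ ω * ξ ω) := Measure.isProbabilityMeasure_map hm
  have hr' : √(r : ℝ) ≠ 0 := by positivity
  have hQ : ∀ a b, AEMeasurable (fun ω => √(r : ℝ) * Q ω a b) P := fun a b =>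
    (h.copies a b).aemeasurable_fst.const_mul _
  refine ⟨aemeasurable_pi_lambda _ fun b => aemeasurable_pi_lambda _ fun a => hQ a b, ?_⟩
  refine map_curry_eq_pi_pi (Z := fun ab ω => √(r : ℝ) * Q ω ab.1 ab.2)
    (h.indep.comp (fun _ x => √(r : ℝ) * x) fun _ => by fun_prop) (fun i => hQ i.1 i.2) fun i => ?_
  have := ((h.copies i.1 i.2).comp (u := fun x => √(r : ℝ) * x) (by fun_prop)).map_eq
  refine this.trans (congrArg (Measure.map · P₀) ?_)
  ext ω
  simp only [Function.comp_apply]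
  field_simp

/-! ### Deterministic part: singular values, coherence and the entrywise error. -/

section SVD

variable {m n k : ℕ} {X : Matrix (Fin m) (Fin n) ℝ} {U : Matrix (Fin m) (Fin k) ℝ}
  {σ : Fin k → ℝ} {V : Matrix (Fin n) (Fin k) ℝ}

theorem norm_toLp_col_of_transpose_mul_self {U : Matrix (Fin m) (Fin k) ℝ} (hU : Uᵀ * U = 1)
    (l : Fin k) : ‖WithLp.toLp 2 fun i => U i l‖ = 1 := by
  have := congrFun (congrFun hU l) l
  rw [Matrix.mul_apply, Matrix.one_apply_eq] at this
  rw [EuclideanSpace.norm_eq, Real.sqrt_eq_one]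
  simpa [sq] using this

/-- `X` maps the `l`-th right singular vector, a unit vector, to `σ l` times a unit vector. -/
theorem IsThinSVD.singular_le_spectralNorm (h : IsThinSVD X U σ V) (l : Fin k) :
    σ l ≤ spectralNorm₂ X := by
  have h1 : X *ᵥ (fun j => V j l) = σ l • fun i => U i l := by
    have hV : Vᵀ *ᵥ (fun j => V j l) = Pi.single l 1 := by
      ext l'
      have := congrFun (congrFun h.right_orthonormal l') l
      rw [Matrix.mul_apply, Matrix.one_apply] at this
      rw [Matrix.mulVec, dotProduct, Pi.single_apply]
      exact this
    rw [h.eq_mul, ← Matrix.mulVec_mulVec, hV]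
    ext i
    simp [Matrix.mul_diagonal, mul_comm]
  have h2 := (LinearMap.toContinuousLinearMap (Matrix.toEuclideanLin X)).le_opNorm
    (WithLp.toLp 2 fun j => V j l)
  rw [norm_toLp_col_of_transpose_mul_self h.right_orthonormal, mul_one,
    LinearMap.coe_toContinuousLinearMap', Matrix.toLpLin_toLp, Matrix.toLin'_apply, h1, WithLp.toLp_smul, norm_smul,
    norm_toLp_col_of_transpose_mul_self h.left_orthonormal, mul_one,
    Real.norm_of_nonneg (h.singular_pos l).le] at h2
  exact h2

theorem sum_mul_sqrt_sq_le {U : Matrix (Fin m) (Fin k) ℝ} {s : ℝ} (hσ0 : ∀ l, 0 ≤ σ l)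
    (hσ : ∀ l, σ l ≤ s) (hs : 0 ≤ s) (i : Fin m) :
    (fun l => U i l * √(σ l)) ⬝ᵥ (fun l => U i l * √(σ l)) ≤
      s * ⨆ i : Fin m, ‖WithLp.toLp 2 (Uᵀ *ᵥ Pi.single i 1)‖ ^ 2 := by
  have h1 : ∑ l, U i l ^ 2 = ‖WithLp.toLp 2 (Uᵀ *ᵥ Pi.single i 1)‖ ^ 2 := by
    rw [EuclideanSpace.norm_sq_eq]
    simp
  have h2 : ‖WithLp.toLp 2 (Uᵀ *ᵥ Pi.single i 1)‖ ^ 2 ≤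
      ⨆ i : Fin m, ‖WithLp.toLp 2 (Uᵀ *ᵥ Pi.single i 1)‖ ^ 2 :=
    le_ciSup (f := fun i : Fin m => ‖WithLp.toLp 2 (Uᵀ *ᵥ Pi.single i 1)‖ ^ 2)
      (Set.finite_range _).bddAbove i
  calc (fun l => U i l * √(σ l)) ⬝ᵥ (fun l => U i l * √(σ l)) = ∑ l, U i l ^ 2 * σ l := by
        refine Finset.sum_congr rfl fun l _ => ?_
        rw [mul_mul_mul_comm, Real.mul_self_sqrt (hσ0 l), sq]
    _ ≤ ∑ l, U i l ^ 2 * s := by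
        gcongr with l; exact hσ l
    _ = s * ‖WithLp.toLp 2 (Uᵀ *ᵥ Pi.single i 1)‖ ^ 2 := by
        rw [← Finset.sum_mul, h1, mul_comm]
    _ ≤ _ := by gcongr

theorem IsThinSVD.apply_eq_dotProduct (h : IsThinSVD X U σ V) (i : Fin m) (j : Fin n) :
    X i j = (fun l => U i l * √(σ l)) ⬝ᵥ (fun l => V j l * √(σ l)) := by
  rw [h.eq_mul, Matrix.mul_apply]
  refine Finset.sum_congr rfl fun l _ => ?_
  rw [Matrix.mul_diagonal, Matrix.transpose_apply, mul_mul_mul_comm,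
    Real.mul_self_sqrt (h.singular_pos l).le]
  ring

theorem sketchOutput_apply {r : ℕ} (hr : 0 < r) (p : ℝ) (Q : Matrix (Fin k) (Fin r) ℝ) (i : Fin m)
    (j : Fin n) :
    sketchOutput p U σ V Q i j = p⁻¹ * ((r : ℝ)⁻¹ *
      ∑ b, ((fun l => U i l * √(σ l)) ⬝ᵥ fun a => √(r : ℝ) * Q a b) *
        ((fun l => V j l * √(σ l)) ⬝ᵥ fun a => √(r : ℝ) * Q a b)) := by
  have hr' : (0 : ℝ) < r := by exact_mod_cast hr
  have hs : ∀ (w : Fin k → ℝ) b, (w ⬝ᵥ fun a => √(r : ℝ) * Q a b) =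
      √(r : ℝ) * ∑ l, w l * Q l b := fun w b => by
    rw [dotProduct, Finset.mul_sum]
    exact Finset.sum_congr rfl fun l _ => by ring
  rw [sketchOutput, Matrix.smul_apply, Matrix.mul_assoc _ (Qᵀ), ← Matrix.transpose_mul,
    Matrix.mul_apply, smul_eq_mul, Finset.mul_sum _ _ (r : ℝ)⁻¹]
  congr 1
  refine Finset.sum_congr rfl fun b _ => ?_
  rw [hs, hs, mul_mul_mul_comm, Real.mul_self_sqrt hr'.le, inv_mul_cancel_left₀ hr'.ne']
  rw [Matrix.transpose_apply, Matrix.mul_apply, Matrix.mul_apply]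
  simp only [Matrix.mul_diagonal]

theorem rank_sketchOutput_le {r : ℕ} (p : ℝ) (Q : Matrix (Fin k) (Fin r) ℝ) :
    (sketchOutput p U σ V Q).rank ≤ r := by
  rw [sketchOutput, Matrix.mul_assoc _ (Qᵀ), ← Matrix.smul_mul]
  exact (Matrix.rank_mul_le_left _ _).trans
    ((Matrix.rank_le_card_width _).trans (by simp))

/-- Entrywise control of the sketched bilinear forms bounds the maximum norm of the error. -/
theorem IsThinSVD.maxNorm_sub_sketchOutput_le (h : IsThinSVD X U σ V) (hm : 0 < m) (hn : 0 < n)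
    (hk : 0 < k) {r : ℕ} (hr : 0 < r) {p ε : ℝ} (hp : 0 < p) (hε : 0 < ε)
    (Q : Matrix (Fin k) (Fin r) ℝ)
    (hQ : ∀ i j, |∑ b, ((fun l => U i l * √(σ l)) ⬝ᵥ fun a => √(r : ℝ) * Q a b) *
          ((fun l => V j l * √(σ l)) ⬝ᵥ fun a => √(r : ℝ) * Q a b) -
        r * (p * ((fun l => U i l * √(σ l)) ⬝ᵥ fun l => V j l * √(σ l)))| ≤
      r * (ε * (√((fun l => U i l * √(σ l)) ⬝ᵥ fun l => U i l * √(σ l)) *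
        √((fun l => V j l * √(σ l)) ⬝ᵥ fun l => V j l * √(σ l))))) :
    maxNorm (X - sketchOutput p U σ V Q) ≤ (k : ℝ) * ε / (p * √((m : ℝ) * (n : ℝ))) *
      √(coherence U * coherence V) * spectralNorm₂ X := by
  have hr' : (0 : ℝ) < r := by exact_mod_cast hr
  have hm' : (0 : ℝ) < m := by exact_mod_cast hm
  have hn' : (0 : ℝ) < n := by exact_mod_cast hn
  have hk' : (0 : ℝ) < k := by exact_mod_cast hk
  have : Nonempty (Fin m × Fin n) := ⟨⟨0, hm⟩, ⟨0, hn⟩⟩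
  set s := spectralNorm₂ X with hs
  have hs0 : 0 ≤ s := norm_nonneg _
  set α : ℝ := ⨆ i : Fin m, ‖WithLp.toLp 2 (Uᵀ *ᵥ Pi.single i 1)‖ ^ 2 with hα
  set β : ℝ := ⨆ j : Fin n, ‖WithLp.toLp 2 (Vᵀ *ᵥ Pi.single j 1)‖ ^ 2 with hβ
  have hα0 : 0 ≤ α := Real.iSup_nonneg fun _ => sq_nonneg _
  have hβ0 : 0 ≤ β := Real.iSup_nonneg fun _ => sq_nonneg _
  -- The factors `m / k` and `n / k` in the coherences cancel against `k / √(m n)`.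
  have hrhs : (k : ℝ) * ε / (p * √((m : ℝ) * (n : ℝ))) * √(coherence U * coherence V) * s =
      ε / p * (√(s * α) * √(s * β)) := by
    have e1 : coherence U * coherence V = (m * n) * (α * β) / k ^ 2 := by
      simp only [coherence, ← hα, ← hβ]; field_simp
    have e2 : √(s * α) * √(s * β) = s * √(α * β) := by
      rw [← Real.sqrt_mul (by positivity), show s * α * (s * β) = s ^ 2 * (α * β) by ring,
        Real.sqrt_mul (by positivity), Real.sqrt_sq hs0]
    have e3 : √((m : ℝ) * n) ≠ 0 := by positivity
    rw [e1, e2, Real.sqrt_div (by positivity), Real.sqrt_sq hk'.le,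
      Real.sqrt_mul (by positivity : (0 : ℝ) ≤ m * n)]
    generalize √((m : ℝ) * n) = t at e3
    field_simp
  rw [hrhs]
  refine ciSup_le fun ij => ?_
  have hu := sum_mul_sqrt_sq_le (U := U) (fun l => (h.singular_pos l).le)
    h.singular_le_spectralNorm hs0 ij.1
  have hv := sum_mul_sqrt_sq_le (U := V) (fun l => (h.singular_pos l).le)
    h.singular_le_spectralNorm hs0 ij.2
  have hq := hQ ij.1 ij.2
  rw [Matrix.sub_apply, h.apply_eq_dotProduct, sketchOutput_apply hr]
  set S := ∑ b, ((fun l => U ij.1 l * √(σ l)) ⬝ᵥ fun a => √(r : ℝ) * Q a b) *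
    ((fun l => V ij.2 l * √(σ l)) ⬝ᵥ fun a => √(r : ℝ) * Q a b)
  set d := (fun l => U ij.1 l * √(σ l)) ⬝ᵥ fun l => V ij.2 l * √(σ l)
  have e4 : d - p⁻¹ * ((r : ℝ)⁻¹ * S) = -((p * r)⁻¹ * (S - r * (p * d))) := by
    field_simp; ring
  rw [e4, abs_neg, abs_mul, abs_of_pos (by positivity)]
  calc (p * r)⁻¹ * |S - r * (p * d)| ≤ (p * r)⁻¹ * (r * (ε * (√(s * α) * √(s * β)))) := by
        refine mul_le_mul_of_nonneg_left (hq.trans ?_) (by positivity)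
        gcongr
    _ = _ := by field_simp

end SVD

/-! ### Union bound and conclusion. -/

/-- Serves both to make the logarithm positive and to close the union bound; the case `m = n = 1` is
where `η ≤ 1 / 2` is needed. -/
theorem two_mul_le_natCast_mul {m n : ℕ} (hm : 0 < m) (hn : 0 < n) {η : ℝ} (h1 : η < 1)
    (h2 : m = 1 → n = 1 → η ≤ 1 / 2) : 2 * η ≤ (m : ℝ) * n := by
  by_cases h : m = 1 ∧ n = 1
  · have := h2 h.1 h.2
    rw [h.1, h.2]; norm_num; linarith
  · have : 2 ≤ m * n := by
      by_contra hc
      have : m * n = 1 := by have := Nat.mul_pos hm hn; omega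
      exact h (by simpa using this)
    have : (2 : ℝ) ≤ (m : ℝ) * n := by exact_mod_cast this
    linarith

theorem mainTheorem5 (K : ℝ) :
    ∃ C : ℝ, 0 < C ∧
      ∀ (m n k r : ℕ) (p : unitInterval) (ε η : ℝ),
        1 ≤ k → k ≤ min m n → 0 < (p : ℝ) → 0 < ε → 0 < η → η < 1 →
        (m = 1 → n = 1 → η ≤ 1 / 2) →
        r ≤ k →
        C * Real.log ((m : ℝ) * (n : ℝ) / η) * max ((p : ℝ) / ε ^ 2) (1 / ε) ≤ (r : ℝ) →
        ∀ X : Matrix (Fin m) (Fin n) ℝ, X.rank = k →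
        ∀ (U : Matrix (Fin m) (Fin k) ℝ) (σ : Fin k → ℝ) (V : Matrix (Fin n) (Fin k) ℝ),
          IsThinSVD X U σ V →
        ∀ {Ω₀ : Type*} [MeasurableSpace Ω₀] (P₀ : Measure Ω₀) [IsProbabilityMeasure P₀]
          (δ ξ : Ω₀ → ℝ), IsSparsifiedPair P₀ p K δ ξ →
        ∀ {Ω : Type*} [MeasurableSpace Ω] (P : Measure Ω) [IsProbabilityMeasure P]
          (Q : Ω → Matrix (Fin k) (Fin r) ℝ), IsSparsifiedSketch P P₀ δ ξ Q →
        (∀ ω, (sketchOutput (p : ℝ) U σ V (Q ω)).rank ≤ r) ∧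
        ENNReal.ofReal (1 - η) ≤
          P {ω | maxNorm (X - sketchOutput (p : ℝ) U σ V (Q ω)) ≤
            (k : ℝ) * ε / ((p : ℝ) * Real.sqrt ((m : ℝ) * (n : ℝ))) *
              Real.sqrt (coherence U * coherence V) * spectralNorm₂ X} := by
  -- Strictly above `K`, so that some admissible `t < K'` exists without attaining the infimum in
  -- `psiTwoNorm`; also positive for every `K`.
  set K' : ℝ := |K| + 1 with hK'
  have hK'0 : 0 < K' := by positivity
  have hKK' : K < K' := by rw [hK']; linarith [le_abs_self K]
  have hL : 0 < K' ^ 2 := by positivity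
  refine ⟨4 / min (3 / (16 * K' ^ 2) / 2) (1 / (2 * (8 / (3 / (16 * K' ^ 2)) ^ 2))),
    by positivity, ?_⟩
  intro m n k r p ε η hk hkmn hp hε hη hη1 hmn1 _ hr X _ U σ V hX Ω₀ _ P₀ _ δ ξ hδξ Ω _ P _ Q hQ
  refine ⟨fun ω => rank_sketchOutput_le _ _, ?_⟩
  have hm : 0 < m := hk.trans (hkmn.trans (min_le_left _ _))
  have hn : 0 < n := hk.trans (hkmn.trans (min_le_right _ _))
  have h2η := two_mul_le_natCast_mul hm hn hη1 hmn1
  have hmn : (0 : ℝ) < (m : ℝ) * n := by positivity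
  have hlog : 0 < Real.log ((m : ℝ) * n / η) :=
    Real.log_pos (by rw [lt_div_iff₀ hη]; linarith)
  have hr0 : 0 < r := by
    have : (0 : ℝ) < r := lt_of_lt_of_le (by positivity) hr
    exact_mod_cast this
  have hmeas : AEMeasurable (fun ω => δ ω * ξ ω) P₀ :=
    hδξ.bernoulli.aemeasurable.mul hδξ.aemeasurable
  have hν := hδξ.isSparseSubgaussian hKK' hK'0
  set ν := P₀.map fun ω => δ ω * ξ ω
  have : IsProbabilityMeasure ν := Measure.isProbabilityMeasure_map hmeas
  obtain ⟨hZm, hZ⟩ := hQ.map_eq_pi_pi hr0 hmeas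
  set PP := Measure.pi fun _ : Fin r => Measure.pi fun _ : Fin k => ν
  set u : Fin m → Fin k → ℝ := fun i l => U i l * √(σ l) with hu
  set v : Fin n → Fin k → ℝ := fun j l => V j l * √(σ l) with hv
  let bad : Fin m × Fin n → Set (Fin r → Fin k → ℝ) := fun ij =>
    {x | r * (ε * (√(u ij.1 ⬝ᵥ u ij.1) * √(v ij.2 ⬝ᵥ v ij.2))) <
      |∑ b, (u ij.1 ⬝ᵥ x b) * (v ij.2 ⬝ᵥ x b) - r * (p * (u ij.1 ⬝ᵥ v ij.2))|}
  have hbadm : ∀ ij, MeasurableSet (bad ij) := fun ij => by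
    refine measurableSet_lt measurable_const ?_
    simp only [dotProduct]
    fun_prop
  have hbad : ∀ ij, PP.real (bad ij) ≤ 2 * Real.exp (-(2 * Real.log ((m : ℝ) * n / η))) :=
    fun ij => hν.measure_abs_gt_le hp p.2.2 hL hε hr (u ij.1) (v ij.2)
  -- Each entry fails with probability at most `2 (η / (m n))²`, so the total is at most `2 η² / (m
  -- n) ≤ η`.
  have hunion : PP.real (⋃ ij, bad ij) ≤ η := by
    refine (measureReal_iUnion_fintype_le _).trans ((Finset.sum_le_sum fun ij _ => hbad ij).trans ?_)
    have : Real.exp (-(2 * Real.log ((m : ℝ) * n / η))) = (((m : ℝ) * n / η) ^ 2)⁻¹ := by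
      rw [Real.exp_neg, mul_comm, Real.exp_mul, Real.exp_log (by positivity)]
      norm_num
    rw [this, Finset.sum_const, Finset.card_univ, Fintype.card_prod, Fintype.card_fin,
      Fintype.card_fin, nsmul_eq_mul]
    push_cast
    have e : (m : ℝ) * n * (2 * (((m : ℝ) * n / η) ^ 2)⁻¹) = 2 * η * η / (m * n) := by
      field_simp
    rw [e, div_le_iff₀ hmn, mul_comm η]
    exact mul_le_mul_of_nonneg_right h2η hη.le
  have hUm : MeasurableSet (⋃ ij, bad ij) := MeasurableSet.iUnion hbadm
  calc ENNReal.ofReal (1 - η) ≤ PP (⋃ ij, bad ij)ᶜ := by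
        rw [← ofReal_measureReal, probReal_compl_eq_one_sub hUm]
        exact ENNReal.ofReal_le_ofReal (by linarith)
    _ = P ((fun ω (b : Fin r) (a : Fin k) => √(r : ℝ) * Q ω a b) ⁻¹' (⋃ ij, bad ij)ᶜ) := by
        rw [← hZ, Measure.map_apply_of_aemeasurable hZm hUm.compl]
    _ ≤ _ := by
        refine measure_mono fun ω hω => ?_
        refine hX.maxNorm_sub_sketchOutput_le hm hn hk hr0 hp hε (Q ω) fun i j => ?_
        by_contra hc
        exact hω (Set.mem_iUnion.2 ⟨(i, j), not_le.1 hc⟩)
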